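/- Let $n\ge 1$, let $p$ be a prime that does not divide $n$, let $K$ be a field of characteristic $p$, and let $a=(a_1,\dots,a_n)\in K^n$ have pairwise distinct coordinates, i.e. $a$ is a $K$-point of $S=\operatorname{Spec}\mathbb Z[z_i,(z_i-z_j)^{-1}]_{i\ne j}$. Let $\hat A=K[[z_1-a_1,\dots,z_n-a_n]]$ be the completion of the local ring of $S_K$ at $a$. The KZ equations $\mathrm{KZ}(h)$ for a column vector $I=(I_1,\dots,I_n)^{\mathsf T}$ are $$\frac{\partial I}{\partial z_i}+h\sum_{j\neq i}\frac{\Omega_{ij}}{z_i-z_j}\,I=0\quad(1\le i\le n),\qquad I_1+\dots+I_n=0,$$ where $\Omega_{ij}$ is the $n\times n$ matrix with entries $-1$ at $(i,i),(j,j)$, entries $1$ at $(i,j),(j,i)$, and zeros elsewhere. Let $T\subset\mathbb P^1_S$ be the union of the sections $x=\infty$ and $x=z_i$ ($1\le i\le n$), let $P=\prod_i(x-z_i)$, and let $\mathcal P^h$ be $\mathcal O_{\mathbb P^1_S}[h,h^{-1}]$ with the logarithmic connection $f\mapsto df+hf\,dP/P$. Let $E=H^1_{dR,\log}(\mathbb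 P^1_S/S,\mathcal P^h)$ be its relative logarithmic de Rham cohomology, i.e. the cokernel of $\nabla:\Gamma(\mathbb P^1_S,\mathcal O)[h,h^{-1}]\to\Gamma(\mathbb P^1_S,\Omega^1_{\mathbb P^1_S/S}(\log T))[h,h^{-1}]$, with its Gauss–Manin connection. 1. Let $R$ be a commutative $\mathbb F_p$-algebra and let $h\in R$ be such that $h^p-h$ is invertible in $R$. Then: (a) $E\otimes_{\mathcal O(S)}\hat A\otimes_{\mathbb Z[h]}R$, with the connection extended by the Leibniz rule, has no nonzero flat sections; (b) the equations $\mathrm{KZ}(h)$ have no nonzero solution $I\in(\hat A\otimes_{\mathbb Z}R)^{n}$, where $\partial/\partial z_i$ acts trivially on $R$. 2. Let $h\in K\setminus\mathbb F_p$. Then $\mathrm{KZ}(h)$ has no nonzero formal solution at $a$ over $K$, i.e. no nonzero solution $I\in\hat A^{\,n}$. -/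

import Mathlib

open scoped TensorProduct

noncomputable section

namespace KZ

/-! ### Extending derivations to localizations -/

section Extend

/-- A derivation over some base ring, as a derivation over `ℤ`. -/
def intDer {S A : Type*} [CommRing S] [CommRing A] [Algebra S A] (D : Derivation S A A) :
    Derivation ℤ A A :=
  Derivation.mk' (D : A →ₗ[S] A).toAddMonoidHom.toIntLinearMap fun a b => D.leibniz a b

theorem intDer_apply {S A : Type*} [CommRing S] [CommRing A] [Algebra S A]
    (D : Derivation S A A) (a : A) : intDer D a = D a := rfl

variable {M A : Type} [CommRing M] [CommRing A] [Algebra M A]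

/-- The unique extension of a derivation of `M` to a localization `A` of `M`. -/
def extendDer (W : Submonoid M) [IsLocalization W A] (D : Derivation ℤ M M) :
    Derivation ℤ A A :=
  haveI : Algebra.FormallyEtale M A := Algebra.FormallyEtale.of_isLocalization W
  ((((Algebra.linearMap M A).compDer D).liftKaehlerDifferential.liftBaseChange A).comp
    (KaehlerDifferential.tensorKaehlerEquivOfFormallyEtale ℤ M A).symm.toLinearMap).compDer
      (KaehlerDifferential.D ℤ A)

/-- The derivation of `A[X]` that applies `D` to the coefficients. -/
def coeffDer {A : Type*} [CommRing A] (D : Derivation ℤ A A) :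
    Derivation ℤ (Polynomial A) (Polynomial A) :=
  @Differential.mapCoeffs A _ ⟨D⟩

theorem coeffDer_C {A : Type*} [CommRing A] (D : Derivation ℤ A A) (a : A) :
    coeffDer D (Polynomial.C a) = Polynomial.C (D a) :=
  @Differential.mapCoeffs_C A _ ⟨D⟩ a

theorem coeffDer_X {A : Type*} [CommRing A] (D : Derivation ℤ A A) :
    coeffDer D (Polynomial.X) = 0 :=
  @Differential.mapCoeffs_X A _ ⟨D⟩

theorem extendDer_algebraMap (W : Submonoid M) [IsLocalization W A] (D : Derivation ℤ M M)
    (m : M) : extendDer (A := A) W D (algebraMap M A m) = algebraMap M A (D m) := by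
  have : Algebra.FormallyEtale M A := Algebra.FormallyEtale.of_isLocalization W
  simp [extendDer, KaehlerDifferential.tensorKaehlerEquivOfFormallyEtale_symm_D_algebraMap]

end Extend

/-! ### The base ring `𝔒 = ℤ[h, h⁻¹, z_i, (z_i - z_j)⁻¹]` -/

/-- `ℤ[h, z_1, …, z_n]`: the variable `none` is `h`, the variable `some i` is `z_i`. -/
abbrev Poly (n : ℕ) : Type := MvPolynomial (Option (Fin n)) ℤ

/-- The multiplicative set generated by `h` and the differences `z_i - z_j`, `i ≠ j`. -/
def denoms (n : ℕ) : Submonoid (Poly n) :=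
  Submonoid.closure ({MvPolynomial.X none} ∪
    {f | ∃ i j : Fin n, i ≠ j ∧ f = MvPolynomial.X (some i) - MvPolynomial.X (some j)})

/-- `𝔒 = ℤ[h, h⁻¹, z_i, (z_i - z_j)⁻¹, i ≠ j]`. -/
def Base (n : ℕ) : Type := Localization (denoms n)

instance (n : ℕ) : CommRing (Base n) := inferInstanceAs (CommRing (Localization (denoms n)))

instance (n : ℕ) : Algebra (Poly n) (Base n) :=
  inferInstanceAs (Algebra (Poly n) (Localization (denoms n)))

instance (n : ℕ) : IsLocalization (denoms n) (Base n) :=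
  inferInstanceAs (IsLocalization (denoms n) (Localization (denoms n)))

variable {n : ℕ}

/-- The parameter `h` in `𝔒`. -/
def hBase (n : ℕ) : Base n := algebraMap (Poly n) (Base n) (MvPolynomial.X none)

/-- The coordinate `z_i` in `𝔒`. -/
def zBase (i : Fin n) : Base n := algebraMap (Poly n) (Base n) (MvPolynomial.X (some i))

/-- The derivation `∂/∂z_i` of `𝔒` (it kills `h`). -/
def dBase (i : Fin n) : Derivation ℤ (Base n) (Base n) :=
  extendDer (denoms n) (intDer (MvPolynomial.pderiv (R := ℤ) (some i)))

theorem dBase_algebraMap (i : Fin n) (f : Poly n) :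
    dBase i (algebraMap (Poly n) (Base n) f) =
      algebraMap (Poly n) (Base n) (MvPolynomial.pderiv (some i) f) :=
  extendDer_algebraMap _ _ f

theorem dBase_h (i : Fin n) : dBase i (hBase n) = 0 := by
  rw [hBase, dBase_algebraMap, MvPolynomial.pderiv_X_of_ne (by simp), map_zero]

theorem dBase_z (i j : Fin n) : dBase i (zBase j) = if i = j then 1 else 0 := by
  rw [zBase, dBase_algebraMap, MvPolynomial.pderiv_X]
  by_cases hij : i = j
  · subst hij; simp
  · rw [Pi.single_eq_of_ne (by simpa using fun h => hij h.symm)]; simp [hij]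

theorem isUnit_zBase_sub {i j : Fin n} (hij : i ≠ j) :
    IsUnit (zBase i - zBase j : Base n) := by
  rw [zBase, zBase, ← map_sub]
  exact IsLocalization.map_units (Base n)
    (⟨_, Submonoid.subset_closure (Or.inr ⟨i, j, hij, rfl⟩)⟩ : denoms n)

/-! ### Functions on `U = ℙ¹_S ∖ T` -/

/-- The polynomial `P = ∏ (x - z_i)` in `𝔒[x]`. -/
def polyP (n : ℕ) : Polynomial (Base n) :=
  ∏ i : Fin n, (Polynomial.X - Polynomial.C (zBase i))

/-- `𝔒[x, P⁻¹]`, the ring of functions on `U`, the complement of the sections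
`x = z_i` and `x = ∞` in the projective line over `𝔒`. -/
def FunU (n : ℕ) : Type := Localization.Away (polyP n)

instance (n : ℕ) : CommRing (FunU n) := inferInstanceAs (CommRing (Localization.Away (polyP n)))

instance (n : ℕ) : Algebra (Polynomial (Base n)) (FunU n) :=
  inferInstanceAs (Algebra (Polynomial (Base n)) (Localization.Away (polyP n)))

instance (n : ℕ) : IsLocalization.Away (polyP n) (FunU n) :=
  inferInstanceAs (IsLocalization.Away (polyP n) (Localization.Away (polyP n)))

instance (n : ℕ) : Algebra (Base n) (FunU n) :=
  ((algebraMap (Polynomial (Base n)) (FunU n)).comp Polynomial.C).toAlgebra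

/-- `∂/∂x` on `U`. -/
def dX (n : ℕ) : Derivation ℤ (FunU n) (FunU n) :=
  extendDer (Submonoid.powers (polyP n)) (intDer (Polynomial.derivative' (R := Base n)))

/-- `∂/∂z_i` on `U` (it kills `x` and `h`). -/
def dZ (i : Fin n) : Derivation ℤ (FunU n) (FunU n) :=
  extendDer (Submonoid.powers (polyP n)) (intDer (coeffDer (dBase i)))

/-- The function `x - z_i` on `U`. -/
def xSub (i : Fin n) : FunU n :=
  algebraMap (Polynomial (Base n)) (FunU n) (Polynomial.X - Polynomial.C (zBase i))

theorem isUnit_xSub (i : Fin n) : IsUnit (xSub i) := by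
  have h : IsUnit (algebraMap (Polynomial (Base n)) (FunU n) (polyP n)) :=
    IsLocalization.Away.algebraMap_isUnit _
  rw [polyP, map_prod] at h
  exact isUnit_of_dvd_unit (Finset.dvd_prod_of_mem
    (fun i => algebraMap (Polynomial (Base n)) (FunU n)
      (Polynomial.X - Polynomial.C (zBase i))) (Finset.mem_univ i)) h

/-- The function `1 / (x - z_i)` on `U`. -/
def pole (i : Fin n) : FunU n := ↑(isUnit_xSub i).unit⁻¹

theorem xSub_mul_pole (i : Fin n) : xSub i * pole i = 1 := (isUnit_xSub i).mul_val_inv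

theorem algebraMap_FunU (o : Base n) : algebraMap (Base n) (FunU n) o =
    algebraMap (Polynomial (Base n)) (FunU n) (Polynomial.C o) := rfl

theorem dX_base (o : Base n) : dX n (algebraMap (Base n) (FunU n) o) = 0 := by
  rw [algebraMap_FunU, dX, extendDer_algebraMap, intDer_apply]
  simp

theorem dZ_base (i : Fin n) (o : Base n) : dZ i (algebraMap (Base n) (FunU n) o) =
    algebraMap (Base n) (FunU n) (dBase i o) := by
  rw [algebraMap_FunU, algebraMap_FunU, dZ, extendDer_algebraMap, intDer_apply, coeffDer_C]

theorem dX_xSub (j : Fin n) : dX n (xSub j) = 1 := by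
  rw [xSub, dX, extendDer_algebraMap, intDer_apply]
  simp

theorem dZ_xSub (i j : Fin n) : dZ i (xSub j) = if i = j then -1 else 0 := by
  rw [xSub, dZ, extendDer_algebraMap, intDer_apply, map_sub, coeffDer_X, coeffDer_C, dBase_z]
  split_ifs <;> simp

theorem der_pole (D : Derivation ℤ (FunU n) (FunU n)) (j : Fin n) :
    D (pole j) = - D (xSub j) * pole j ^ 2 := by
  have h := congrArg D (xSub_mul_pole j)
  rw [Derivation.leibniz, Derivation.map_one_eq_zero] at h
  simp only [smul_eq_mul] at h
  linear_combination (pole j) * h - (D (pole j)) * xSub_mul_pole j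

theorem dX_pole (j : Fin n) : dX n (pole j) = - pole j ^ 2 := by
  rw [der_pole, dX_xSub]; ring

theorem dZ_pole (i j : Fin n) : dZ i (pole j) = if i = j then pole j ^ 2 else 0 := by
  rw [der_pole, dZ_xSub]; split_ifs <;> ring

theorem pole_mul_pole {i j : Fin n} (hij : i ≠ j) :
    pole i * pole j =
      (↑(isUnit_zBase_sub hij).unit⁻¹ : Base n) • (pole i - pole j) := by
  set w : Base n := ↑(isUnit_zBase_sub hij).unit⁻¹ with hw
  have h1 : algebraMap (Base n) (FunU n) w * (xSub j - xSub i) = 1 := by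
    have : xSub j - xSub i = algebraMap (Base n) (FunU n) (zBase i - zBase j) := by
      simp only [xSub, algebraMap_FunU, map_sub]; ring
    rw [this, ← map_mul, hw, IsUnit.val_inv_mul, map_one]
  rw [Algebra.smul_def]
  linear_combination (-(pole i * pole j)) * h1
    + algebraMap (Base n) (FunU n) w * (pole i) * xSub_mul_pole j
    - algebraMap (Base n) (FunU n) w * (pole j) * xSub_mul_pole i

/-! ### Logarithmic forms and the rank one connection `∇ = d + h η` -/

/-- An absolute `1`-form `f dx + ∑ c_k dz_k` on `U` (relative to `ℤ[h, h⁻¹]`) is written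
as the pair `(f, c)`. -/
abbrev FormU (n : ℕ) : Type := FunU n × (Fin n → FunU n)

/-- `d(x - z_j)/(x - z_j)` as an absolute form. -/
def dlog (j : Fin n) : FormU n := (pole j, Pi.single j (-pole j))

/-- The form `dz_k`. -/
def dz (k : Fin n) : FormU n := (0, Pi.single k 1)

/-- Global absolute logarithmic `1`-forms on `(ℙ¹_S, T)`: the `𝔒`-module generated by the
forms `d(x - z_j)/(x - z_j)` and `dz_k`. -/
def LogAbs (n : ℕ) : Submodule (Base n) (FormU n) :=
  Submodule.span (Base n) (Set.range dlog ∪ Set.range dz)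

/-- Global relative logarithmic `1`-forms `f dx` on `(ℙ¹_S, T)` over `S` (written as `f`):
the `𝔒`-module generated by the forms `η_j = d(x - z_j)/(x - z_j) = dx/(x - z_j)`. -/
def LogRel (n : ℕ) : Submodule (Base n) (FunU n) :=
  Submodule.span (Base n) (Set.range pole)

theorem pole_mem (j : Fin n) : pole j ∈ LogRel n := Submodule.subset_span ⟨j, rfl⟩

/-- The `dx`-component `P'/P = ∑ 1/(x - z_j)` of `η = dP/P`; its `dz_i`-component is
`-1/(x - z_i)`. -/
def etaX (n : ℕ) : FunU n := ∑ j : Fin n, pole j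

theorem etaX_mem : etaX n ∈ LogRel n := Submodule.sum_mem _ fun j _ => pole_mem j

/-- The parameter `h` as a function on `U`. -/
def hU (n : ℕ) : FunU n := algebraMap (Base n) (FunU n) (hBase n)

/-- `∇_{∂/∂x} = ∂/∂x + h P'/P`. -/
def nablaX (f : FunU n) : FunU n := dX n f + hU n * etaX n * f

/-- `∇_{∂/∂z_i} = ∂/∂z_i - h/(x - z_i)`. -/
def nablaZ (i : Fin n) (f : FunU n) : FunU n := dZ i f - hU n * pole i * f

/-- The logarithmic de Rham differential `∇ : Γ(𝒪) = 𝔒 → Γ(Ω¹_{ℙ¹_S/S}(log T))`,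
`f ↦ df + h f η = h f η` on the relative complex. -/
def logDiff (n : ℕ) : Base n →ₗ[Base n] LogRel n :=
  LinearMap.toSpanSingleton (Base n) (LogRel n) (hBase n • ⟨etaX n, etaX_mem⟩)

theorem coe_logDiff (o : Base n) :
    (logDiff n o : FunU n) = nablaX (algebraMap (Base n) (FunU n) o) := by
  simp [logDiff, nablaX, dX_base, hU, Algebra.smul_def]
  ring

/-- `E = H¹_{dR,log}(ℙ¹_S/S, 𝒫^h)`, the cokernel of
`∇ : Γ(ℙ¹_S, 𝒪) → Γ(ℙ¹_S, Ω¹_{ℙ¹_S/S}(log T))`. -/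
abbrev E (n : ℕ) : Type := LogRel n ⧸ LinearMap.range (logDiff n)

/-! ### The Gauss–Manin connection on `E` -/

/-- The coefficient of `dz_i ∧ dx` in `∇μ = dμ + h η ∧ μ` for an absolute form
`μ = f dx + ∑ c_k dz_k`. -/
def curl (i : Fin n) : FormU n →+ FunU n where
  toFun μ := nablaZ i μ.1 - nablaX (μ.2 i)
  map_zero' := by simp [nablaZ, nablaX]
  map_add' μ ν := by simp [nablaZ, nablaX]; ring

theorem curl_smul (i : Fin n) (o : Base n) (μ : FormU n) :
    curl i (o • μ) = dBase i o • μ.1 + o • curl i μ := by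
  have h1 : (o • μ).1 = algebraMap (Base n) (FunU n) o * μ.1 := Algebra.smul_def o μ.1
  have h2 : (o • μ).2 i = algebraMap (Base n) (FunU n) o * μ.2 i := Algebra.smul_def o (μ.2 i)
  simp only [curl, nablaZ, nablaX, AddMonoidHom.coe_mk, ZeroHom.coe_mk, h1, h2,
    Algebra.smul_def (R := Base n) (A := FunU n), Derivation.leibniz, smul_eq_mul, dX_base,
    dZ_base]
  ring

theorem curl_dlog (i j : Fin n) : curl i (dlog j) =
    -(hU n * (pole i * pole j)) + if i = j then hU n * etaX n * pole j else 0 := by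
  by_cases hij : i = j
  · subst hij
    simp [curl, dlog, nablaZ, nablaX, dX_pole, dZ_pole]
    ring
  · simp [curl, dlog, nablaZ, nablaX, dZ_pole, Pi.single_eq_of_ne hij, hij]
    ring

theorem curl_dz (i k : Fin n) : curl i (dz k) = if i = k then -(hU n * etaX n) else 0 := by
  by_cases hij : i = k
  · subst hij
    simp [curl, dz, nablaZ, nablaX]
  · simp [curl, dz, nablaZ, nablaX, Pi.single_eq_of_ne hij, hij]

theorem hU_mul_mem {f : FunU n} (hf : f ∈ LogRel n) : hU n * f ∈ LogRel n := by
  rw [hU, ← Algebra.smul_def]; exact Submodule.smul_mem _ _ hf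

theorem pole_mul_pole_mem {i j : Fin n} (hij : i ≠ j) : pole i * pole j ∈ LogRel n := by
  rw [pole_mul_pole hij]
  exact Submodule.smul_mem _ _ (Submodule.sub_mem _ (pole_mem i) (pole_mem j))

theorem fst_mem {μ : FormU n} (hμ : μ ∈ LogAbs n) : μ.1 ∈ LogRel n := by
  induction hμ using Submodule.span_induction with
  | mem x hx =>
    rcases hx with ⟨j, rfl⟩ | ⟨k, rfl⟩
    · exact pole_mem j
    · exact Submodule.zero_mem _
  | zero => exact Submodule.zero_mem _
  | add x y _ _ hx hy => exact Submodule.add_mem _ hx hy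
  | smul o x _ hx => exact Submodule.smul_mem _ o hx

theorem curl_mem (i : Fin n) {μ : FormU n} (hμ : μ ∈ LogAbs n) : curl i μ ∈ LogRel n := by
  induction hμ using Submodule.span_induction with
  | mem x hx =>
    rcases hx with ⟨j, rfl⟩ | ⟨k, rfl⟩
    · rw [curl_dlog]
      by_cases hij : i = j
      · subst hij
        rw [if_pos rfl, etaX, ← Finset.add_sum_erase _ _ (Finset.mem_univ i)]
        have : -(hU n * (pole i * pole i)) +
            hU n * (pole i + ∑ k ∈ Finset.univ.erase i, pole k) * pole i =
            hU n * ∑ k ∈ Finset.univ.erase i, pole k * pole i := by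
          rw [← Finset.sum_mul]; ring
        rw [this]
        exact hU_mul_mem (Submodule.sum_mem _ fun k hk =>
          pole_mul_pole_mem (Finset.ne_of_mem_erase hk))
      · rw [if_neg hij, add_zero]
        exact Submodule.neg_mem _ (hU_mul_mem (pole_mul_pole_mem hij))
    · rw [curl_dz]
      split_ifs
      · exact Submodule.neg_mem _ (hU_mul_mem etaX_mem)
      · exact Submodule.zero_mem _
  | zero => rw [map_zero]; exact Submodule.zero_mem _
  | add x y _ _ hx hy => rw [map_add]; exact Submodule.add_mem _ hx hy
  | smul o x hx' hx =>
    rw [curl_smul]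
    exact Submodule.add_mem _ (Submodule.smul_mem _ _ (fst_mem hx')) (Submodule.smul_mem _ _ hx)

theorem polyP_monic : (polyP n).Monic :=
  Polynomial.monic_prod_of_monic _ _ fun i _ => Polynomial.monic_X_sub_C _

theorem pole_independent (o : Fin n → Base n) (ho : ∑ j, o j • pole j = 0) (i : Fin n) :
    o i = 0 := by
  have hinj : Function.Injective (algebraMap (Polynomial (Base n)) (FunU n)) :=
    IsLocalization.injective _ (M := Submonoid.powers (polyP n))
      (Submonoid.powers_le.mpr polyP_monic.mem_nonZeroDivisors)
  have key : ∑ j, Polynomial.C (o j) *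
      ∏ k ∈ Finset.univ.erase j, (Polynomial.X - Polynomial.C (zBase k)) = 0 := by
    apply hinj
    rw [map_zero, map_sum]
    have h2 := congrArg (fun t => (∏ k, xSub k) * t) ho
    simp only [mul_zero, Finset.mul_sum] at h2
    rw [← h2]
    refine Finset.sum_congr rfl fun j _ => ?_
    rw [map_mul, map_prod, ← algebraMap_FunU, Algebra.smul_def,
      ← Finset.mul_prod_erase _ _ (Finset.mem_univ j)]
    change _ * ∏ k ∈ Finset.univ.erase j, xSub k = _
    linear_combination (-(algebraMap (Base n) (FunU n) (o j) *
      ∏ k ∈ Finset.univ.erase j, xSub k)) * xSub_mul_pole j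
  have h3 := congrArg (Polynomial.eval (zBase i)) key
  rw [Polynomial.eval_zero, Polynomial.eval_finsetSum, Finset.sum_eq_single i] at h3
  · rw [Polynomial.eval_mul, Polynomial.eval_C, Polynomial.eval_prod] at h3
    refine (IsUnit.mul_left_eq_zero ?_).mp h3
    refine IsUnit.prod_iff.mpr fun k hk => ?_
    simpa using isUnit_zBase_sub (Finset.ne_of_mem_erase hk).symm
  · intro j _ hji
    rw [Polynomial.eval_mul, Polynomial.eval_prod,
      Finset.prod_eq_zero (Finset.mem_erase.mpr ⟨hji.symm, Finset.mem_univ i⟩) (by simp), mul_zero]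
  · simp

theorem exists_coeffs {μ : FormU n} (hμ : μ ∈ LogAbs n) :
    ∃ o d : Fin n → Base n, μ = ∑ j, o j • dlog j + ∑ k, d k • dz k := by
  induction hμ using Submodule.span_induction with
  | mem x hx =>
    rcases hx with ⟨j, rfl⟩ | ⟨k, rfl⟩
    · exact ⟨Pi.single j 1, 0, by simp [Pi.single_apply, ite_smul]⟩
    · exact ⟨0, Pi.single k 1, by simp [Pi.single_apply, ite_smul]⟩
  | zero => exact ⟨0, 0, by simp⟩
  | add x y _ _ hx hy =>
    obtain ⟨o, d, rfl⟩ := hx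
    obtain ⟨o', d', rfl⟩ := hy
    refine ⟨o + o', d + d', ?_⟩
    simp only [Pi.add_apply, add_smul, Finset.sum_add_distrib]
    abel
  | smul c x _ hx =>
    obtain ⟨o, d, rfl⟩ := hx
    exact ⟨c • o, c • d, by simp [smul_add, Finset.smul_sum, smul_smul]⟩

theorem fst_sum_dlog (o d : Fin n → Base n) :
    (∑ j, o j • dlog j + ∑ k, d k • dz k).1 = ∑ j, o j • pole j := by
  simp [Prod.fst_sum, dlog, dz]

/-- The class in `E` of the relative form underlying an absolute logarithmic form. -/
def classMap (n : ℕ) : LogAbs n →+ E n where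
  toFun μ := Submodule.Quotient.mk ⟨μ.1.1, fst_mem μ.2⟩
  map_zero' := rfl
  map_add' _ _ := rfl

/-- The class in `E` of the relative form `ι_{∂/∂z_i} ∇μ`. -/
def curlClass (i : Fin n) : LogAbs n →+ E n where
  toFun μ := Submodule.Quotient.mk ⟨curl i μ.1, curl_mem i μ.2⟩
  map_zero' := by
    rw [Submodule.Quotient.mk_eq_zero]
    convert Submodule.zero_mem _
    simp
  map_add' μ ν := by
    rw [← Submodule.Quotient.mk_add]
    congr 1
    exact Subtype.ext (map_add (curl i) _ _)

theorem classMap_surjective : Function.Surjective (classMap n) := by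
  intro e
  obtain ⟨⟨f, hf⟩, rfl⟩ := Submodule.Quotient.mk_surjective _ e
  obtain ⟨o, rfl⟩ := (Submodule.mem_span_range_iff_exists_fun (Base n)).mp hf
  refine ⟨⟨∑ j, o j • dlog j, Submodule.sum_mem _ fun j _ => Submodule.smul_mem _ _
    (Submodule.subset_span (Or.inl ⟨j, rfl⟩))⟩, ?_⟩
  change Submodule.Quotient.mk _ = _
  congr 1
  apply Subtype.ext
  simp [Prod.fst_sum, dlog]

theorem curl_sum_dlog (i : Fin n) : curl i (∑ j, dlog j) = 0 := by
  rw [map_sum]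
  simp only [curl_dlog, Finset.sum_add_distrib, Finset.sum_neg_distrib, ← Finset.mul_sum]
  simp [etaX]
  ring

theorem ker_classMap_le (i : Fin n) : (classMap n).ker ≤ (curlClass i).ker := by
  rintro ⟨μ, hμ⟩ h
  rw [AddMonoidHom.mem_ker] at h ⊢
  obtain ⟨g, hg⟩ := (Submodule.Quotient.mk_eq_zero _).mp h
  obtain ⟨o, d, rfl⟩ := exists_coeffs hμ
  have hg' := congrArg Subtype.val hg
  simp only [fst_sum_dlog] at hg'
  have h1 : ∀ j, o j = g * hBase n := by
    intro j
    refine sub_eq_zero.mp (pole_independent (fun j => o j - g * hBase n) ?_ j)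
    simp only [sub_smul, Finset.sum_sub_distrib, ← hg', ← Finset.smul_sum]
    simp [logDiff, smul_smul, etaX]
  refine (Submodule.Quotient.mk_eq_zero _).mpr ⟨dBase i g - d i, Subtype.ext ?_⟩
  have h2 : curl i (∑ k, d k • dz k) = - (d i • (hU n * etaX n)) := by
    rw [map_sum]
    simp only [curl_smul, curl_dz]
    simp [dz]
  have h3 : curl i (∑ j, o j • dlog j) = (dBase i g * hBase n) • etaX n := by
    simp only [h1, ← Finset.smul_sum]
    rw [curl_smul, curl_sum_dlog, Derivation.leibniz, dBase_h]
    simp [Prod.fst_sum, dlog, etaX, mul_comm]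
  change _ = curl i (_ + _)
  rw [map_add, h2, h3]
  simp [logDiff, Algebra.smul_def, hU]
  ring

/-- The Gauss–Manin connection `∇^E_{∂/∂z_i}` on `E`: the class of a relative form `ω` goes to
the class of `ι_{∂/∂z_i} ∇μ`, where `μ` is any absolute logarithmic form that lifts `ω`. -/
def gaussManin (i : Fin n) : E n →+ E n :=
  (classMap n).liftOfRightInverse (Function.surjInv classMap_surjective)
    (Function.rightInverse_surjInv classMap_surjective) ⟨curlClass i, ker_classMap_le i⟩

theorem gaussManin_classMap (i : Fin n) (μ : LogAbs n) :
    gaussManin i (classMap n μ) = curlClass i μ :=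
  AddMonoidHom.liftOfRightInverse_comp_apply _ _ _ _ _

theorem gaussManin_smul (i : Fin n) (o : Base n) (e : E n) :
    gaussManin i (o • e) = dBase i o • e + o • gaussManin i e := by
  obtain ⟨μ, rfl⟩ := classMap_surjective e
  have h1 : o • classMap n μ = classMap n (o • μ) := rfl
  rw [h1, gaussManin_classMap, gaussManin_classMap]
  change Submodule.Quotient.mk _ = Submodule.Quotient.mk _
  congr 1
  exact Subtype.ext (curl_smul i o μ.1)

/-! ### Base change of `E` -/

/-- The extension of the Gauss–Manin connection to `B ⊗ E` by the Leibniz formula, for an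
`𝔒`-algebra `B` with a derivation `D` that extends `∂/∂z_i`. -/
def gaussManinBaseChange {B : Type*} [CommRing B] [Algebra (Base n) B] (i : Fin n)
    (D : Derivation ℤ B B)
    (hD : ∀ o : Base n, D (algebraMap (Base n) B o) = algebraMap (Base n) B (dBase i o)) :
    (B ⊗[Base n] E n) →+ (B ⊗[Base n] E n) :=
  TensorProduct.liftAddHom
    { toFun := fun b =>
        { toFun := fun e => D b ⊗ₜ e + b ⊗ₜ gaussManin i e
          map_zero' := by simp
          map_add' := fun e e' => by
            simp only [map_add, TensorProduct.tmul_add]; abel }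
      map_zero' := by ext; simp
      map_add' := fun b b' => by
        ext e
        simp only [map_add, TensorProduct.add_tmul, AddMonoidHom.coe_mk, ZeroHom.coe_mk,
          AddMonoidHom.add_apply]
        abel }
    (fun o b e => by
      have h1 : D (o • b) = o • D b + dBase i o • b := by
        simp only [Algebra.smul_def (R := Base n) (A := B), Derivation.leibniz, hD,
          smul_eq_mul, mul_comm b]
      simp only [AddMonoidHom.coe_mk, ZeroHom.coe_mk, gaussManin_smul, h1,
        TensorProduct.tmul_add, TensorProduct.add_tmul, TensorProduct.tmul_smul,
        TensorProduct.smul_tmul']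
      abel)

/-- The ring `B`, as an `A`-algebra through `φ : A → B`. -/
def Via {A B : Type*} [CommRing A] [CommRing B] (_ : A →+* B) : Type _ := B

instance {A B : Type*} [CommRing A] [CommRing B] (φ : A →+* B) : CommRing (Via φ) :=
  inferInstanceAs (CommRing B)

instance {A B : Type*} [CommRing A] [CommRing B] (φ : A →+* B) : Algebra A (Via φ) :=
  RingHom.toAlgebra (S := Via φ) φ

/-! ### The ring `A ⊗_ℤ R` -/

/-- The ring `A ⊗_ℤ R`. -/
def Tensor (A R : Type*) [CommRing A] [CommRing R] : Type _ := A ⊗[ℤ] R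

namespace Tensor

variable {A R : Type*} [CommRing A] [CommRing R]

instance : CommRing (Tensor A R) := inferInstanceAs (CommRing (A ⊗[ℤ] R))

/-- `a ↦ a ⊗ 1`. -/
def inl : A →+* Tensor A R := (Algebra.TensorProduct.includeLeft : A →ₐ[ℤ] A ⊗[ℤ] R).toRingHom

/-- `r ↦ 1 ⊗ r`. -/
def inr : R →+* Tensor A R := (Algebra.TensorProduct.includeRight : R →ₐ[ℤ] A ⊗[ℤ] R).toRingHom

/-- The derivation `D ⊗ id` of `A ⊗ R`. -/
def der (D : Derivation ℤ A A) : Derivation ℤ (Tensor A R) (Tensor A R) :=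
  Derivation.mk' (((D : A →ₗ[ℤ] A).rTensor R).toAddMonoidHom.toIntLinearMap :
      Tensor A R →ₗ[ℤ] Tensor A R) (by
    have H : ∀ f g : A ⊗[ℤ] R, (D : A →ₗ[ℤ] A).rTensor R (f * g) =
        f * (D : A →ₗ[ℤ] A).rTensor R g + g * (D : A →ₗ[ℤ] A).rTensor R f := by
      intro f g
      induction f using TensorProduct.induction_on with
      | zero => simp
      | add f f' hf hf' => simp only [add_mul, map_add, hf, hf', mul_add]; abel
      | tmul f r =>
        induction g using TensorProduct.induction_on with
        | zero => simp
        | add g g' hg hg' => simp only [mul_add, map_add, hg, hg', add_mul]; abel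
        | tmul g s =>
          simp only [Algebra.TensorProduct.tmul_mul_tmul, LinearMap.rTensor_tmul,
            Derivation.coeFn_coe, Derivation.leibniz, smul_eq_mul, TensorProduct.add_tmul,
            mul_comm s r]
    exact H)

theorem der_inl (D : Derivation ℤ A A) (a : A) :
    der D (inl a : Tensor A R) = inl (D a) := rfl

theorem der_inr (D : Derivation ℤ A A) (r : R) : der D (inr r : Tensor A R) = 0 := by
  change D 1 ⊗ₜ[ℤ] r = (0 : A ⊗[ℤ] R)
  simp

end Tensor

/-! ### The formal neighbourhood of a point of `S` -/

section Formal

variable {K : Type*} [Field K] {R : Type*} [CommRing R]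

/-- `Â ⊗ R`, where `Â = K[[z_1 - a_1, …, z_n - a_n]]` is the completed local ring of `S_K` at a
`K`-point `a`; the variable `X i` of the power series ring is `z_i - a_i`. -/
abbrev FormalRing (n : ℕ) (K : Type*) [Field K] (R : Type*) [CommRing R] : Type _ :=
  Tensor (MvPowerSeries (Fin n) K) R

/-- The coordinate function `z_i = a_i + X i` in `Â`. -/
def zHat (a : Fin n → K) (i : Fin n) : MvPowerSeries (Fin n) K :=
  MvPowerSeries.C (a i) + MvPowerSeries.X i

/-- The derivation `∂/∂z_i` of `Â ⊗ R` (trivial on `R`). -/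
def dFormal (i : Fin n) : Derivation ℤ (FormalRing n K R) (FormalRing n K R) :=
  Tensor.der (intDer (MvPowerSeries.pderiv K i))

theorem dFormal_inl (i : Fin n) (f : MvPowerSeries (Fin n) K) :
    dFormal i (Tensor.inl f : FormalRing n K R) = Tensor.inl (MvPowerSeries.pderiv K i f) :=
  Tensor.der_inl _ f

theorem dFormal_inr (i : Fin n) (r : R) : dFormal i (Tensor.inr r : FormalRing n K R) = 0 :=
  Tensor.der_inr _ r

/-- `ℤ[h, z_1, …, z_n] → Â ⊗ R`, `z_i ↦ z_i`, `h ↦ h`. -/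
def evalPoly (a : Fin n → K) (h : R) : Poly n →+* FormalRing n K R :=
  MvPolynomial.eval₂Hom (Int.castRingHom _)
    (fun o => o.elim (Tensor.inr h) fun i => Tensor.inl (zHat a i))

theorem isUnit_zHat_sub {a : Fin n → K} (ha : Function.Injective a) {i j : Fin n} (hij : i ≠ j) :
    IsUnit (zHat a i - zHat a j) := by
  rw [MvPowerSeries.isUnit_iff_constantCoeff]
  simpa [zHat, sub_eq_zero] using ha.ne hij

theorem isUnit_evalPoly {a : Fin n → K} (ha : Function.Injective a) {h : R} (hh : IsUnit h)
    (y : denoms n) : IsUnit (evalPoly a h y) := by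
  suffices H : denoms n ≤ (IsUnit.submonoid (FormalRing n K R)).comap
      (evalPoly a h : Poly n →* FormalRing n K R) from H y.2
  refine Submonoid.closure_le.mpr ?_
  rintro f (rfl | ⟨i, j, hij, rfl⟩)
  · change IsUnit (evalPoly a h (MvPolynomial.X none))
    simpa [evalPoly] using
      hh.map (Tensor.inr : R →+* FormalRing n K R)
  · change IsUnit (evalPoly a h (MvPolynomial.X (some i) - MvPolynomial.X (some j)))
    simpa [evalPoly] using (isUnit_zHat_sub ha hij).map
      (Tensor.inl : MvPowerSeries (Fin n) K →+* FormalRing n K R)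

/-- The ring homomorphism `𝔒 → Â ⊗ R`, `z_i ↦ z_i`, `h ↦ h`. -/
def evalBase {a : Fin n → K} (ha : Function.Injective a) {h : R} (hh : IsUnit h) :
    Base n →+* FormalRing n K R :=
  IsLocalization.lift (M := denoms n) (isUnit_evalPoly ha hh)

theorem dFormal_evalPoly (a : Fin n → K) (h : R) (i : Fin n) (f : Poly n) :
    dFormal i (evalPoly a h f) = evalPoly a h (MvPolynomial.pderiv (some i) f) := by
  induction f using MvPolynomial.induction_on with
  | C c => simp [evalPoly]
  | add f g hf hg => simp only [map_add, hf, hg]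
  | mul_X f o hf =>
    have hX : dFormal i (evalPoly a h (MvPolynomial.X o)) =
        evalPoly a h (MvPolynomial.pderiv (some i) (MvPolynomial.X o : Poly n)) := by
      rcases o with _ | j
      · simp [evalPoly, dFormal_inr, MvPolynomial.pderiv_X_of_ne]
      · by_cases hij : j = i
        · subst hij
          simp [evalPoly, dFormal_inl, zHat]
        · rw [MvPolynomial.pderiv_X_of_ne (by simpa using hij)]
          simp [evalPoly, dFormal_inl, zHat, MvPowerSeries.pderiv_X_of_ne, hij]
    simp only [map_mul, Derivation.leibniz, smul_eq_mul, map_add, hX, hf]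

theorem dFormal_evalBase {a : Fin n → K} (ha : Function.Injective a) {h : R} (hh : IsUnit h)
    (i : Fin n) (o : Base n) :
    dFormal i (evalBase ha hh o) = evalBase ha hh (dBase i o) := by
  obtain ⟨f, s, rfl⟩ := IsLocalization.exists_mk'_eq (denoms n) o
  set o := IsLocalization.mk' (Base n) f s
  have hmap : ∀ g : Poly n, evalBase ha hh (algebraMap (Poly n) (Base n) g) = evalPoly a h g :=
    fun g => IsLocalization.lift_eq _ g
  have h0 : o * algebraMap _ _ (s : Poly n) = algebraMap _ _ f := IsLocalization.mk'_spec _ f s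
  have h1 := congrArg (fun t => dFormal i (evalBase ha hh t)) h0
  have h2 := congrArg (fun t => evalBase ha hh (dBase i t)) h0
  simp only [map_mul, Derivation.leibniz, smul_eq_mul, map_add, hmap, dFormal_evalPoly,
    dBase_algebraMap] at h1 h2
  have h3 := h1.trans h2.symm
  refine (isUnit_evalPoly ha hh s).mul_left_cancel ?_
  linear_combination h3

/-- `E ⊗_{𝒪(S)} Â ⊗_{ℤ[h]} R`, that is, `(Â ⊗ R) ⊗_𝔒 E`. -/
abbrev EFormal {a : Fin n → K} (ha : Function.Injective a) {h : R} (hh : IsUnit h) : Type _ :=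
  Via (evalBase ha hh) ⊗[Base n] E n

/-- The connection on `E ⊗_{𝒪(S)} Â ⊗_{ℤ[h]} R` along `∂/∂z_i`. -/
def nablaFormal {a : Fin n → K} (ha : Function.Injective a) {h : R} (hh : IsUnit h) (i : Fin n) :
    EFormal ha hh →+ EFormal ha hh :=
  gaussManinBaseChange (B := Via (evalBase ha hh)) i (dFormal i) (dFormal_evalBase ha hh i)

end Formal

theorem isUnit_of_pow_sub {R : Type*} [CommRing R] {p : ℕ} (hp : p.Prime) {h : R}
    (hh : IsUnit (h ^ p - h)) : IsUnit h :=
  isUnit_of_dvd_unit (dvd_sub (dvd_pow_self h hp.ne_zero) dvd_rfl) hh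

/-! ### The KZ equations -/

/-- The matrix `Ω_{ij}` for `i ≠ j`: entries `-1` at `(i,i)` and `(j,j)`, entries `1` at `(i,j)`
and `(j,i)`, and `0` elsewhere. -/
def Omega (B : Type*) [CommRing B] (i j : Fin n) : Matrix (Fin n) (Fin n) B :=
  Matrix.of fun k l =>
    if (k = i ∧ l = i) ∨ (k = j ∧ l = j) then -1
    else if (k = i ∧ l = j) ∨ (k = j ∧ l = i) then 1 else 0

/-- The Gaudin Hamiltonian `H_i(z) = ∑_{j ≠ i} Ω_{ij} / (z_i - z_j)`, for elements `z_i` of a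
commutative ring whose differences are invertible. -/
def gaudin {B : Type*} [CommRing B] (z : Fin n → B) (i : Fin n) : Matrix (Fin n) (Fin n) B :=
  ∑ j ∈ Finset.univ.erase i, Ring.inverse (z i - z j) • Omega B i j

/-- `I` solves the KZ equations `∂_i I + h H_i(z) I = 0`, `I_1 + … + I_n = 0`. -/
def IsKZSolution {B : Type*} [CommRing B] (D : Fin n → B → B) (z : Fin n → B) (h : B)
    (I : Fin n → B) : Prop :=
  (∀ i, (fun k => D i (I k)) + h • (gaudin z i).mulVec I = 0) ∧ ∑ k, I k = 0

end KZ

end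

noncomputable section

namespace KZ

/-! Everything is read off along the Euler field `θ = ∑ z_i ∂_i`, where both systems become scalar
with eigenvalue `hn`. For KZ, pairing the terms `(i,j)` and `(j,i)` gives `∑ z_i H_i = ∑_{i<j}
Ω_{ij}`, which is `-n` on vectors of coordinate sum zero, so a solution satisfies `θ I = hn I`
(`IsKZSolution.euler_eq`). For Gauss–Manin, the classes of `dx/(x - z_j)` generate `E` and satisfy
`∇_θ e_j = hn e_j` (`sum_zBase_smul_gaussManin`).

In characteristic `p` one has `θ^p = θ`: the operators `z_i ∂_i` commute, and `X^p - X` is the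
falling factorial mod `p`, whose value at `z_i ∂_i` is `z_i^p ∂_i^p = 0` (`derEnd_euler_pow_prime`).
Hence `θ f = c f` with `θ c = 0` forces `(c^p - c) f = 0`, and likewise `∇_θ^p - ∇_θ` is the scalar
`(hn)^p - hn` (`iterate_prime_eulerGaussManin`). Since `n^p = n` in characteristic `p`, this scalar
is `n (h^p - h)`, a unit because `p ∤ n`; so solutions and flat sections vanish. -/

-- Modulo `p` both polynomials are monic of degree `p` and vanish on all of `𝔽_p`. The congruence is
-- lifted to `ℤ[X]` so that it can be evaluated at `ℤ`-linear endomorphisms.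
open Polynomial in
theorem exists_descPochhammer_prime_eq {p : ℕ} (hp : p.Prime) :
    ∃ q : ℤ[X], descPochhammer ℤ p = X ^ p - X + C (p : ℤ) * q := by
  have : Fact p.Prime := ⟨hp⟩
  suffices h : C (p : ℤ) ∣ descPochhammer ℤ p - (X ^ p - X) by
    obtain ⟨q, hq⟩ := h
    exact ⟨q, by rw [← hq]; ring⟩
  have hmap : descPochhammer (ZMod p) p = X ^ p - X := by
    have hdeg : (X ^ p - X : (ZMod p)[X]).natDegree = p :=
      FiniteField.X_pow_card_sub_X_natDegree_eq _ hp.one_lt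
    have hmonic : (X ^ p - X : (ZMod p)[X]).Monic :=
      monic_X_pow_sub (by rw [degree_X]; exact_mod_cast hp.one_lt)
    -- The leading terms cancel, so the difference has degree below `p` and is determined by its
    -- values at the `p` points of `𝔽_p`.
    refine eq_of_degree_sub_lt_of_eval_finset_eq (Finset.univ : Finset (ZMod p)) ?_ ?_
    · have hp0 := (monic_descPochhammer (ZMod p) p).ne_zero
      have h1 : degree (descPochhammer (ZMod p) p) = p := by
        rw [degree_eq_natDegree hp0, descPochhammer_natDegree]
      have h2 : degree (X ^ p - X : (ZMod p)[X]) = p := by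
        rw [degree_eq_natDegree hmonic.ne_zero, hdeg]
      rw [Finset.card_univ, ZMod.card]
      exact (degree_sub_lt_left (h1.trans h2.symm) hp0
        ((monic_descPochhammer _ p).leadingCoeff.trans hmonic.leadingCoeff.symm)).trans_eq h1
    · intro x _
      have hx : x = ((x.val : ℕ) : ZMod p) := (ZMod.natCast_zmod_val x).symm
      rw [hx, descPochhammer_eval_coe_nat_of_lt (ZMod.val_lt x)]
      simp [ZMod.pow_card]
  rw [C_dvd_iff_dvd_coeff]
  intro i
  have h := congrArg (fun f => coeff f i) hmap
  rw [← descPochhammer_map (Int.castRingHom (ZMod p)) p] at h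
  rw [← ZMod.intCast_zmod_eq_zero_iff_dvd _ p, coeff_sub, Int.cast_sub, sub_eq_zero]
  have h2 : (X ^ p - X : (ZMod p)[X]) = (X ^ p - X : ℤ[X]).map (Int.castRingHom (ZMod p)) := by
    simp
  rw [h2] at h
  simpa only [coeff_map, eq_intCast] using h

/-- The Frobenius identity for commuting elements; the ring itself may be noncommutative, as is
needed for `Module.End`. -/
theorem sum_pow_prime_of_commute {A ι : Type*} [Ring A] {p : ℕ} (hp : p.Prime)
    (hp0 : (p : A) = 0) (s : Finset ι) (x : ι → A)
    (hx : ∀ i j, Commute (x i) (x j)) : (∑ i ∈ s, x i) ^ p = ∑ i ∈ s, x i ^ p := by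
  classical
  induction s using Finset.induction_on with
  | empty => simp [hp.ne_zero]
  | insert i s hi ih =>
    obtain ⟨r, hr⟩ := (Commute.sum_right s x (x i) fun j _ => hx i j).exists_add_pow_prime_eq hp
    rw [Finset.sum_insert hi, Finset.sum_insert hi, hr, ih, hp0]
    simp

theorem natCast_end_eq_zero {A : Type*} [CommRing A] {p : ℕ} (hp0 : (p : A) = 0) :
    (p : Module.End ℤ A) = 0 := by
  ext f
  rw [← nsmul_one, LinearMap.smul_apply, Module.End.one_apply, nsmul_eq_mul, hp0, zero_mul,
    LinearMap.zero_apply]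

/-! ### Derivations in characteristic `p` and the identity `θ^p = θ` -/

section Euler

variable {A : Type*} [CommRing A]

/-- A derivation as an endomorphism of the additive group. -/
def derEnd (D : Derivation ℤ A A) : Module.End ℤ A := (D : A →ₗ[ℤ] A)

theorem derEnd_apply (D : Derivation ℤ A A) (f : A) : derEnd D f = D f := rfl

/-- The classical `θ(θ-1)⋯(θ-k+1) = z^k D^k` for `θ = zD`. The inductive step is `(θ - k)(z^k g) =
z^(k+1) D g`, because `θ(z^k) = k z^k`. -/
theorem aeval_descPochhammer_derEnd (D : Derivation ℤ A A) {z : A} (hz : D z = 1) (k : ℕ) (f : A) :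
    Polynomial.aeval (derEnd (z • D)) (descPochhammer ℤ k) f = z ^ k * (derEnd D ^ k) f := by
  induction k with
  | zero => simp
  | succ k ih =>
    rw [descPochhammer_succ_right, mul_comm, map_mul, Module.End.mul_apply, ih]
    have hzk : D (z ^ k) * z = k * z ^ k := by
      rw [Derivation.leibniz_pow, hz]
      -- The exponent `k - 1` from the power rule truncates at `k = 0`.
      rcases k with _ | k
      · simp
      · simp [pow_succ]; ring
    simp only [map_sub, Polynomial.aeval_X, map_natCast, LinearMap.sub_apply, derEnd_apply,
      Derivation.smul_apply, smul_eq_mul, Derivation.leibniz, pow_succ', Module.End.mul_apply]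
    rw [← nsmul_one (A := Module.End ℤ A), LinearMap.smul_apply, Module.End.one_apply,
      nsmul_eq_mul]
    linear_combination ((derEnd D ^ k) f) * hzk

/-- The falling factorial of `zD` is `z^p D^p = 0`, and it agrees with `X^p - X` at `zD` because `p`
acts as zero. -/
theorem derEnd_smul_pow_prime {p : ℕ} (hp : p.Prime) (hp0 : (p : A) = 0) (D : Derivation ℤ A A)
    {z : A} (hz : D z = 1) (hD : derEnd D ^ p = 0) :
    derEnd (z • D) ^ p = derEnd (z • D) := by
  obtain ⟨q, hq⟩ := exists_descPochhammer_prime_eq hp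
  have h : Polynomial.aeval (derEnd (z • D)) (descPochhammer ℤ p) = 0 := by
    ext f
    rw [aeval_descPochhammer_derEnd D hz, hD]
    simp
  rw [hq] at h
  simp only [map_add, map_sub, map_mul, map_pow, Polynomial.aeval_X, map_natCast,
    natCast_end_eq_zero hp0, zero_mul, add_zero] at h
  exact sub_eq_zero.mp h

variable {ι : Type*} [Fintype ι]

/-- The Euler derivation `∑ z_i ∂_i`. -/
def euler (D : ι → Derivation ℤ A A) (z : ι → A) : Derivation ℤ A A := ∑ i, z i • D i

theorem euler_apply (D : ι → Derivation ℤ A A) (z : ι → A) (f : A) :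
    euler D z f = ∑ i, z i * D i f := by
  change Derivation.coeFnAddMonoidHom (∑ i, z i • D i) f = _
  rw [map_sum, Finset.sum_apply]
  rfl

theorem derEnd_euler_pow_prime [DecidableEq ι] {p : ℕ} (hp : p.Prime) (hp0 : (p : A) = 0)
    (D : ι → Derivation ℤ A A) (z : ι → A) (hz : ∀ i j, D i (z j) = if i = j then 1 else 0)
    (hcomm : ∀ i j f, D i (D j f) = D j (D i f)) (hD : ∀ i, derEnd (D i) ^ p = 0) :
    derEnd (euler D z) ^ p = derEnd (euler D z) := by
  have h : derEnd (euler D z) = ∑ i, derEnd (z i • D i) := by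
    ext f
    simp [derEnd_apply, euler_apply]
  rw [h, sum_pow_prime_of_commute hp (natCast_end_eq_zero hp0)]
  · exact Finset.sum_congr rfl fun i _ => derEnd_smul_pow_prime hp hp0 _ (by simp [hz]) (hD i)
  · intro i j
    by_cases hij : i = j
    -- For `i ≠ j` the operators commute since `D_i z_j = 0` and `D_i`, `D_j` commute.
    · subst hij; exact Commute.refl _
    · refine LinearMap.ext fun f => ?_
      simp only [Module.End.mul_apply, derEnd_apply, Derivation.smul_apply, smul_eq_mul,
        Derivation.leibniz, hz, if_neg hij, if_neg (Ne.symm hij), hcomm i j f]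
      ring

/-- Since `D c = 0`, multiplication by `c` commutes with `D` and the Frobenius identity applies. -/
theorem derEnd_add_mulLeft_pow_prime {p : ℕ} (hp : p.Prime) (hp0 : (p : A) = 0)
    (D : Derivation ℤ A A) (hD : derEnd D ^ p = derEnd D) {c : A} (hc : D c = 0) :
    (derEnd D + LinearMap.mulLeft ℤ c) ^ p = derEnd D + LinearMap.mulLeft ℤ (c ^ p) := by
  have h : Commute (derEnd D) (LinearMap.mulLeft ℤ c) := by
    refine LinearMap.ext fun f => ?_
    simp [Module.End.mul_apply, derEnd_apply, hc]
  obtain ⟨r, hr⟩ := h.exists_add_pow_prime_eq hp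
  rw [hr, hD, natCast_end_eq_zero hp0, LinearMap.pow_mulLeft]
  simp

theorem natCast_pow_prime {p : ℕ} (hp : p.Prime) (hp0 : (p : A) = 0) (n : ℕ) :
    (n : A) ^ p = n := by
  have h : (((n : ℤ) ^ p - n : ℤ) : A) = 0 := by
    have : Fact p.Prime := ⟨hp⟩
    obtain ⟨k, hk⟩ := (ZMod.intCast_zmod_eq_zero_iff_dvd ((n : ℤ) ^ p - n) p).mp
      (by push_cast; rw [ZMod.pow_card, sub_self])
    rw [hk]
    push_cast
    rw [hp0, zero_mul]
  push_cast at h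
  exact sub_eq_zero.mp h

theorem isUnit_natCast {p n : ℕ} (hp : p.Prime) (hp0 : (p : A) = 0) (hpn : ¬ p ∣ n) :
    IsUnit (n : A) := by
  have h : IsCoprime (n : ℤ) (p : ℤ) :=
    Nat.isCoprime_iff_coprime.mpr ((Nat.Prime.coprime_iff_not_dvd hp).mpr hpn).symm
  have h2 := h.map (Int.castRingHom A)
  simpa [hp0, isCoprime_zero_right] using h2

/-- The condition `p ∤ n` enters here: `(hn)^p - hn = (h^p - h) n`, and `n` is invertible by Bézout.
-/
theorem isUnit_mul_natCast_pow_sub {p n : ℕ} (hp : p.Prime) (hp0 : (p : A) = 0) (hpn : ¬ p ∣ n)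
    {h : A} (hh : IsUnit (h ^ p - h)) : IsUnit ((h * n) ^ p - h * n) := by
  rw [mul_pow, natCast_pow_prime hp hp0, ← sub_mul]
  exact hh.mul (isUnit_natCast hp hp0 hpn)

/-- Iterating `D f = c f` with `c` constant gives `D^p f = c^p f`, while `D^p f = D f = c f`. -/
theorem eq_zero_of_der_eq_mul {p : ℕ} {D : Derivation ℤ A A} (hD : derEnd D ^ p = derEnd D)
    {c : A} (hc : D c = 0) (hcp : IsUnit (c ^ p - c)) {f : A} (hf : D f = c * f) : f = 0 := by
  have h : ∀ k : ℕ, (derEnd D ^ k) f = c ^ k * f := by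
    intro k
    induction k with
    | zero => simp
    | succ k ih =>
      rw [pow_succ', Module.End.mul_apply, ih, derEnd_apply, Derivation.leibniz,
        Derivation.leibniz_pow, hc, hf]
      simp only [smul_eq_mul, mul_zero, smul_zero, add_zero]
      ring
  have h2 := h p
  rw [hD, derEnd_apply, hf] at h2
  exact hcp.mul_right_eq_zero.mp (by rw [sub_mul, ← h2, sub_self])

end Euler

/-! ### The Euler operator on solutions of the KZ equations -/

section Solutions

variable {A : Type*} [CommRing A] {n : ℕ}

theorem Omega_mulVec {i j : Fin n} (hij : i ≠ j) (I : Fin n → A) (k : Fin n) :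
    (Omega A i j).mulVec I k =
      (if k = i then I j - I i else 0) + if k = j then I i - I j else 0 := by
  have h : ∀ l, Omega A i j k l * I l =
      (if k = i then (if l = j then I l else 0) - (if l = i then I l else 0) else 0) +
      if k = j then (if l = i then I l else 0) - (if l = j then I l else 0) else 0 := by
    intro l
    simp only [Omega, Matrix.of_apply]
    by_cases hki : k = i <;> by_cases hkj : k = j <;> by_cases hli : l = i <;>
      by_cases hlj : l = j <;> simp_all
  simp only [Matrix.mulVec, dotProduct, h, Finset.sum_add_distrib]
  congr 1 <;> split_ifs <;> simp

/-- Since `z_i/(z_i - z_j) + z_j/(z_j - z_i) = 1`, the sum is `∑_{i<j} Ω_{ij} I`. Its `k`-th entry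
is `∑_j (I_j - I_k)`, which is `-n I_k` when the coordinates of `I` sum to zero. -/
theorem sum_mul_gaudin_mulVec {z : Fin n → A} (hz : ∀ i j, i ≠ j → IsUnit (z i - z j))
    {I : Fin n → A} (hI : ∑ k, I k = 0) (k : Fin n) :
    ∑ i, z i * (gaudin z i).mulVec I k = -(n * I k) := by
  have hneg : ∀ i j, i ≠ j → Ring.inverse (z i - z j) = - Ring.inverse (z j - z i) := by
    intro i j hij
    linear_combination -Ring.inverse (z j - z i) * Ring.mul_inverse_cancel _ (hz i j hij) -
      Ring.inverse (z i - z j) * Ring.mul_inverse_cancel _ (hz j i hij.symm)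
  have h1 : ∀ i, (gaudin z i).mulVec I k = ∑ j, if i = j then 0 else
      Ring.inverse (z i - z j) *
        ((if k = i then I j - I i else 0) + if k = j then I i - I j else 0) := by
    intro i
    rw [gaudin, Matrix.sum_mulVec, Finset.sum_apply, ← Finset.add_sum_erase _ _ (Finset.mem_univ i),
      if_pos rfl, zero_add]
    refine Finset.sum_congr rfl fun j hj => ?_
    have hij := (Finset.ne_of_mem_erase hj).symm
    rw [if_neg hij, Matrix.smul_mulVec, Pi.smul_apply, smul_eq_mul, Omega_mulVec hij]
  -- Only pairs containing `k` contribute; they are split into those with `i = k` and those with `j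
  -- = k`, with all denominators brought to the form `z_k - z_•`.
  have h2 : ∀ i j, z i * (if i = j then 0 else Ring.inverse (z i - z j) *
        ((if k = i then I j - I i else 0) + if k = j then I i - I j else 0)) =
      (if i = k then (if k = j then 0 else z k * Ring.inverse (z k - z j) * (I j - I k)) else 0) +
      (if j = k then (if k = i then 0 else -(z i * Ring.inverse (z k - z i) * (I i - I k)))
        else 0) := by
    intro i j
    by_cases hij : i = j
    · subst hij
      by_cases hik : i = k
      · subst hik; simp
      · simp [hik]
    · by_cases hki : k = i
      · subst hki; simp [hij, Ne.symm hij]; ring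
      · by_cases hkj : k = j
        · subst hkj
          simp [hij, Ne.symm hij, hneg i k hij]
          ring
        · simp [hij, hki, hkj, Ne.symm hki, Ne.symm hkj]
  simp only [h1, Finset.mul_sum, h2, Finset.sum_add_distrib]
  rw [Finset.sum_comm (f := fun i j => if j = k then _ else _)]
  -- The contributions of `(k,j)` and `(j,k)` combine, and the factor `z_k - z_j` cancels the
  -- denominator.
  have h3 : ∀ j, (if k = j then 0 else z k * Ring.inverse (z k - z j) * (I j - I k)) +
      (if k = j then 0 else -(z j * Ring.inverse (z k - z j) * (I j - I k))) = I j - I k := by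
    intro j
    by_cases hkj : k = j
    · subst hkj; simp
    · rw [if_neg hkj, if_neg hkj]
      linear_combination (I j - I k) * Ring.mul_inverse_cancel _ (hz k j hkj)
  have h4 : ∑ j, (I j - I k) = -(n * I k) := by
    rw [Finset.sum_sub_distrib, hI]; simp
  rw [← h4, ← Finset.sum_congr rfl fun j _ => h3 j, Finset.sum_add_distrib]
  congr 1 <;> simp [Finset.sum_ite_irrel]

theorem IsKZSolution.euler_eq {D : Fin n → Derivation ℤ A A} {z : Fin n → A}
    (hz : ∀ i j, i ≠ j → IsUnit (z i - z j)) {h : A} {I : Fin n → A}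
    (hI : IsKZSolution (fun i => D i) z h I) (k : Fin n) :
    euler D z (I k) = h * n * I k := by
  have h1 : ∀ i, D i (I k) = -(h * (gaudin z i).mulVec I k) := fun i =>
    eq_neg_of_add_eq_zero_left (congrFun (hI.1 i) k)
  simp only [euler_apply, h1]
  have h2 := sum_mul_gaudin_mulVec hz hI.2 k
  calc ∑ i, z i * -(h * (gaudin z i).mulVec I k)
      = -(h * ∑ i, z i * (gaudin z i).mulVec I k) := by
        rw [Finset.mul_sum, ← Finset.sum_neg_distrib]
        exact Finset.sum_congr rfl fun i _ => by ring
    _ = h * n * I k := by rw [h2]; ring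

/-- The ring is kept general so that the same argument serves both `Â ⊗ R` and `Â`. -/
theorem IsKZSolution.eq_zero {p : ℕ} (hp : p.Prime) (hp0 : (p : A) = 0) (hpn : ¬ p ∣ n)
    {D : Fin n → Derivation ℤ A A} {z : Fin n → A}
    (hz : ∀ i j, i ≠ j → IsUnit (z i - z j))
    (hD : derEnd (euler D z) ^ p = derEnd (euler D z)) {h : A} (hh : IsUnit (h ^ p - h))
    (hDh : ∀ i, D i h = 0) {I : Fin n → A} (hI : IsKZSolution (fun i => D i) z h I) : I = 0 := by
  funext k
  refine eq_zero_of_der_eq_mul hD ?_ (isUnit_mul_natCast_pow_sub hp hp0 hpn hh) (hI.euler_eq hz k)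
  simp [euler_apply, hDh]

end Solutions

/-! ### The Euler operator on the Gauss–Manin connection -/

section GaussManin

variable {n : ℕ}

theorem dlog_mem (j : Fin n) : dlog j ∈ LogAbs n := Submodule.subset_span (Or.inl ⟨j, rfl⟩)

/-- The class of `dx/(x - z_j)` in `E`. -/
def poleClass (j : Fin n) : E n := classMap n ⟨dlog j, dlog_mem j⟩

theorem span_poleClass : Submodule.span (Base n) (Set.range (poleClass (n := n))) = ⊤ := by
  refine eq_top_iff.mpr fun e _ => ?_
  obtain ⟨⟨f, hf⟩, rfl⟩ := Submodule.Quotient.mk_surjective _ e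
  obtain ⟨o, rfl⟩ := (Submodule.mem_span_range_iff_exists_fun (Base n)).mp hf
  have h : (⟨∑ j, o j • pole j, hf⟩ : LogRel n) = ∑ j, o j • ⟨pole j, pole_mem j⟩ :=
    Subtype.ext (by simp)
  rw [h, ← Submodule.mkQ_apply, map_sum]
  refine Submodule.sum_mem _ fun j _ => ?_
  rw [map_smul]
  exact Submodule.smul_mem _ _ (Submodule.subset_span ⟨j, rfl⟩)

/-- Writing `z_i = z_j + (z_i - z_j)` and using `z_i - z_j = (x - z_j) - (x - z_i)` turns each
product of poles into a difference of poles plus a multiple of `z_j`. Over all `i` those multiples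
add up to `-z_j h η_x/(x - z_j)`, where `η_x = P'/P`, and cancel the extra term of `curl_dlog` at `i
= j`. -/
theorem sum_zBase_smul_curl_dlog (j : Fin n) :
    ∑ i, zBase i • curl i (dlog j) = (hBase n * n) • pole j - hBase n • etaX n := by
  have h1 : ∀ i, zBase i • curl i (dlog j) =
      hU n * (pole j - pole i) - algebraMap (Base n) (FunU n) (zBase j) * (hU n * pole i * pole j) +
      if i = j then algebraMap (Base n) (FunU n) (zBase j) * (hU n * etaX n * pole j) else 0 := by
    intro i
    have hz : algebraMap (Base n) (FunU n) (zBase i) - algebraMap (Base n) (FunU n) (zBase j) =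
        xSub j - xSub i := by
      simp only [xSub, algebraMap_FunU, map_sub]; ring
    have h2 : algebraMap (Base n) (FunU n) (zBase i) * -(hU n * (pole i * pole j)) =
        hU n * (pole j - pole i) -
          algebraMap (Base n) (FunU n) (zBase j) * (hU n * pole i * pole j) := by
      linear_combination -(hU n * pole i * pole j) * hz + hU n * pole j * xSub_mul_pole i
        - hU n * pole i * xSub_mul_pole j
    rw [curl_dlog, Algebra.smul_def, mul_add, h2]
    congr 1
    split_ifs with hij
    · rw [hij]
    · rw [mul_zero]
  simp only [h1, Finset.sum_add_distrib, Finset.sum_sub_distrib, ← Finset.mul_sum,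
    ← Finset.sum_mul, Finset.sum_ite_eq', Finset.mem_univ, if_true]
  rw [← etaX, Algebra.smul_def, Algebra.smul_def, map_mul, map_natCast, ← hU]
  simp
  ring

theorem sum_zBase_smul_gaussManin (j : Fin n) :
    ∑ i, zBase i • gaussManin i (poleClass j) = (hBase n * n) • poleClass j := by
  rw [← sub_eq_zero]
  simp only [poleClass, gaussManin_classMap]
  -- The discrepancy is `-h P'/P`, the image of the constant `-1`, hence zero in `E`.
  have h : (∑ i, zBase i • (⟨curl i (dlog j), curl_mem i (dlog_mem j)⟩ : LogRel n)) -
      (hBase n * n) • ⟨pole j, pole_mem j⟩ = logDiff n (-1) := by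
    apply Subtype.ext
    simp only [Submodule.coe_sub, Submodule.coe_sum, Submodule.coe_smul,
      sum_zBase_smul_curl_dlog]
    simp [logDiff]
  have h2 := congrArg (LinearMap.range (logDiff n)).mkQ h
  rw [map_sub, map_sum] at h2
  simp only [map_smul] at h2
  refine h2.trans ((Submodule.Quotient.mk_eq_zero _).mpr ⟨_, rfl⟩)

variable {B : Type*} [CommRing B] [Algebra (Base n) B] (D : Fin n → Derivation ℤ B B)
  (hD : ∀ i (o : Base n), D i (algebraMap (Base n) B o) = algebraMap (Base n) B (dBase i o))

theorem gaussManinBaseChange_tmul (i : Fin n) (b : B) (e : E n) :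
    gaussManinBaseChange i (D i) (hD i) (b ⊗ₜ e) = D i b ⊗ₜ e + b ⊗ₜ gaussManin i e := rfl

/-- The covariant derivative `∑ z_i ∇_i` along the Euler field on `B ⊗ E`. -/
def eulerGaussManin : (B ⊗[Base n] E n) →+ (B ⊗[Base n] E n) :=
  ∑ i, (DistribSMul.toAddMonoidHom (B ⊗[Base n] E n) (zBase i)).comp
    (gaussManinBaseChange i (D i) (hD i))

theorem eulerGaussManin_apply (v : B ⊗[Base n] E n) : eulerGaussManin D hD v =
    ∑ i, zBase i • gaussManinBaseChange i (D i) (hD i) v := by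
  simp [eulerGaussManin]

/-- As `e_j` is an eigenvector of `∇_θ`, the derivative acts on the coefficient alone, through `θ +
hn`; iterates therefore reduce to powers of one operator on `B`. -/
theorem eulerGaussManin_tmul_poleClass (b : B) (j : Fin n) :
    eulerGaussManin D hD (b ⊗ₜ poleClass j) =
      ((derEnd (euler D fun i => algebraMap (Base n) B (zBase i)) +
        LinearMap.mulLeft ℤ (algebraMap (Base n) B (hBase n) * n)) b) ⊗ₜ poleClass j := by
  simp only [eulerGaussManin_apply, gaussManinBaseChange_tmul, smul_add, Finset.sum_add_distrib,
    TensorProduct.smul_tmul', LinearMap.add_apply, TensorProduct.add_tmul, derEnd_apply,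
    euler_apply, TensorProduct.sum_tmul]
  congr 1
  · simp only [Algebra.smul_def]
  · simp only [TensorProduct.smul_tmul, ← TensorProduct.tmul_sum, sum_zBase_smul_gaussManin]
    rw [← TensorProduct.smul_tmul, Algebra.smul_def, map_mul, map_natCast, LinearMap.mulLeft_apply]

theorem iterate_eulerGaussManin_tmul_poleClass (k : ℕ) (b : B) (j : Fin n) :
    (eulerGaussManin D hD)^[k] (b ⊗ₜ poleClass j) =
      (((derEnd (euler D fun i => algebraMap (Base n) B (zBase i)) +
        LinearMap.mulLeft ℤ (algebraMap (Base n) B (hBase n) * n)) ^ k) b) ⊗ₜ poleClass j := by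
  induction k generalizing b with
  | zero => rfl
  | succ k ih =>
    rw [Function.iterate_succ_apply, eulerGaussManin_tmul_poleClass, ih, pow_succ,
      Module.End.mul_apply]

/-- Because `θ^p = θ`, this computes the `p`-curvature along `θ`, and it is scalar. Both sides are
additive, so it suffices to test on `b ⊗ e_j`; the `e_j` need only generate `E`, not form a basis.
-/
theorem iterate_prime_eulerGaussManin {p : ℕ} (hp : p.Prime) (hp0 : (p : B) = 0)
    (hE : derEnd (euler D fun i => algebraMap (Base n) B (zBase i)) ^ p =
      derEnd (euler D fun i => algebraMap (Base n) B (zBase i))) (v : B ⊗[Base n] E n) :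
    (eulerGaussManin D hD)^[p] v = eulerGaussManin D hD v +
      ((algebraMap (Base n) B (hBase n) * n) ^ p - algebraMap (Base n) B (hBase n) * n) • v := by
  have hc : euler D (fun i => algebraMap (Base n) B (zBase i))
      (algebraMap (Base n) B (hBase n) * n) = 0 := by
    simp [euler_apply, hD, dBase_h]
  have hiter : ∀ v w, (eulerGaussManin D hD)^[p] (v + w) =
      (eulerGaussManin D hD)^[p] v + (eulerGaussManin D hD)^[p] w := iterate_map_add _ p
  induction v using TensorProduct.induction_on with
  | zero => simp [iterate_map_zero]
  | add v w hv hw =>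
    rw [hiter, hv, hw, map_add, smul_add]
    abel
  | tmul b e =>
    have he : e ∈ Submodule.span (Base n) (Set.range (poleClass (n := n))) := by
      rw [span_poleClass]; trivial
    induction he using Submodule.span_induction generalizing b with
    | mem e he =>
      obtain ⟨j, rfl⟩ := he
      rw [iterate_eulerGaussManin_tmul_poleClass, eulerGaussManin_tmul_poleClass,
        derEnd_add_mulLeft_pow_prime hp hp0 _ hE hc, TensorProduct.smul_tmul',
        ← TensorProduct.add_tmul]
      congr 1
      simp only [LinearMap.add_apply, LinearMap.mulLeft_apply, smul_eq_mul]
      ring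
    | zero => simp [iterate_map_zero]
    | add e e' _ _ he he' =>
      rw [TensorProduct.tmul_add, hiter, he, he', map_add, smul_add]
      abel
    | smul o e _ he =>
      -- The scalar is absorbed into `b`, over which the induction hypothesis is quantified, so the
      -- Leibniz rule is not needed.
      rw [← TensorProduct.smul_tmul]
      exact he _

theorem eq_zero_of_flat {p : ℕ} (hp : p.Prime) (hp0 : (p : B) = 0) (hpn : ¬ p ∣ n)
    (hE : derEnd (euler D fun i => algebraMap (Base n) B (zBase i)) ^ p =
      derEnd (euler D fun i => algebraMap (Base n) B (zBase i)))
    (hh : IsUnit (algebraMap (Base n) B (hBase n) ^ p - algebraMap (Base n) B (hBase n)))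
    {v : B ⊗[Base n] E n} (hv : ∀ i, gaussManinBaseChange i (D i) (hD i) v = 0) : v = 0 := by
  have h0 : eulerGaussManin D hD v = 0 := by
    rw [eulerGaussManin_apply]
    exact Finset.sum_eq_zero fun i _ => by rw [hv i, smul_zero]
  have h1 := iterate_prime_eulerGaussManin D hD hp hp0 hE v
  -- As `p ≥ 1`, the `p`-fold iterate also kills `v`, leaving the unit scalar times `v` equal to
  -- zero.
  rw [h0, zero_add, ← Nat.succ_pred_eq_of_pos hp.pos, Function.iterate_succ_apply, h0,
    iterate_map_zero, Nat.succ_pred_eq_of_pos hp.pos] at h1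
  exact (isUnit_mul_natCast_pow_sub hp hp0 hpn hh).smul_eq_zero.mp h1.symm

end GaussManin

/-! ### Formal power series in characteristic `p` -/

section PowerSeries

variable {K : Type*} [Field K] {n p : ℕ}

theorem pderiv_comm (i j : Fin n) (f : MvPowerSeries (Fin n) K) :
    MvPowerSeries.pderiv K i (MvPowerSeries.pderiv K j f) =
      MvPowerSeries.pderiv K j (MvPowerSeries.pderiv K i f) := by
  by_cases hij : i = j
  · rw [hij]
  ext m
  simp only [MvPowerSeries.coeff_pderiv, Finsupp.add_apply, Finsupp.single_eq_of_ne hij,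
    Finsupp.single_eq_of_ne (Ne.symm hij), add_zero, add_right_comm m]
  ring

theorem coeff_iterate_pderiv (i : Fin n) (k : ℕ) (f : MvPowerSeries (Fin n) K) (m : Fin n →₀ ℕ) :
    MvPowerSeries.coeff m ((derEnd (intDer (MvPowerSeries.pderiv K i)) ^ k) f) =
      MvPowerSeries.coeff (m + Finsupp.single i k) f * ((m i + k).descFactorial k : ℕ) := by
  induction k generalizing m with
  | zero => simp
  | succ k ih =>
    rw [pow_succ', Module.End.mul_apply, derEnd_apply, intDer_apply, MvPowerSeries.coeff_pderiv, ih,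
      add_assoc, ← Finsupp.single_add, add_comm 1 k, Finsupp.add_apply, Finsupp.single_eq_same,
      mul_assoc, add_assoc, add_comm 1 k, Nat.descFactorial_succ]
    congr 1
    rw [show m i + (k + 1) - k = m i + 1 by omega]
    push_cast
    ring

/-- Each coefficient acquires a product of `p` consecutive integers, which is divisible by `p!` and
so by `p`. -/
theorem derEnd_pderiv_pow_prime [CharP K p] (hp : p.Prime) (i : Fin n) :
    derEnd (intDer (MvPowerSeries.pderiv K i)) ^ p = 0 := by
  refine LinearMap.ext fun f => MvPowerSeries.ext fun m => ?_
  have h : (((m i + p).descFactorial p : ℕ) : K) = 0 :=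
    (CharP.cast_eq_zero_iff K p _).mpr ((Nat.dvd_factorial hp.pos le_rfl).trans
      (Nat.factorial_dvd_descFactorial _ _))
  rw [coeff_iterate_pderiv, h, mul_zero, LinearMap.zero_apply, map_zero]

theorem pderiv_zHat (a : Fin n → K) (i j : Fin n) :
    MvPowerSeries.pderiv K i (zHat a j) = if i = j then 1 else 0 := by
  rw [zHat, map_add, MvPowerSeries.pderiv_C, zero_add]
  split_ifs with hij
  · rw [hij, MvPowerSeries.pderiv_X_self]
  · exact MvPowerSeries.pderiv_X_of_ne (Ne.symm hij)

theorem natCast_mvPowerSeries_eq_zero [CharP K p] : (p : MvPowerSeries (Fin n) K) = 0 := by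
  rw [← map_natCast (MvPowerSeries.C (σ := Fin n) (R := K)), CharP.cast_eq_zero, map_zero]

theorem derEnd_euler_mvPowerSeries_pow_prime [CharP K p] (hp : p.Prime) (a : Fin n → K) :
    derEnd (euler (fun i => intDer (MvPowerSeries.pderiv K i)) (zHat a)) ^ p =
      derEnd (euler (fun i => intDer (MvPowerSeries.pderiv K i)) (zHat a)) :=
  derEnd_euler_pow_prime hp natCast_mvPowerSeries_eq_zero _ _ (pderiv_zHat a) pderiv_comm
    (derEnd_pderiv_pow_prime hp)

/-! ### Transfer to `Â ⊗ R` and conclusion for flat sections -/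

variable {R : Type*} [CommRing R]

theorem natCast_formalRing_eq_zero [CharP K p] : (p : FormalRing n K R) = 0 := by
  rw [← map_natCast (Tensor.inl : MvPowerSeries (Fin n) K →+* FormalRing n K R),
    natCast_mvPowerSeries_eq_zero, map_zero]

/-- Commutation of the `∂_i` and `∂_i^p = 0` pass from `Â` to `Â ⊗ R` by functoriality of `- ⊗ R`.
-/
theorem derEnd_euler_formalRing_pow_prime [CharP K p] (hp : p.Prime) (a : Fin n → K) :
    derEnd (euler (fun i => (dFormal i : Derivation ℤ (FormalRing n K R) _))
        fun i => Tensor.inl (zHat a i)) ^ p =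
      derEnd (euler (fun i => (dFormal i : Derivation ℤ (FormalRing n K R) _))
        fun i => Tensor.inl (zHat a i)) := by
  refine derEnd_euler_pow_prime hp natCast_formalRing_eq_zero _ _ ?_ ?_ ?_
  · intro i j
    rw [dFormal_inl, pderiv_zHat]
    split_ifs <;> simp
  · intro i j f
    have h : derEnd (intDer (MvPowerSeries.pderiv K i)) * derEnd (intDer (MvPowerSeries.pderiv K j))
        = derEnd (intDer (MvPowerSeries.pderiv K j)) * derEnd (intDer (MvPowerSeries.pderiv K i)) :=
      LinearMap.ext (pderiv_comm i j)
    have h2 := congrArg (LinearMap.rTensor R) h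
    rw [LinearMap.rTensor_mul, LinearMap.rTensor_mul] at h2
    exact LinearMap.congr_fun h2 f
  · intro i
    have h := LinearMap.rTensor_pow (N := R) (derEnd (intDer (MvPowerSeries.pderiv K i))) p
    rw [derEnd_pderiv_pow_prime hp, LinearMap.rTensor_zero] at h
    exact h

theorem isUnit_inr_pow_sub {h : R} (hh : IsUnit (h ^ p - h)) :
    IsUnit ((Tensor.inr h : FormalRing n K R) ^ p - Tensor.inr h) := by
  simpa using hh.map (Tensor.inr : R →+* FormalRing n K R)

theorem evalBase_z {a : Fin n → K} (ha : Function.Injective a) {h : R} (hh : IsUnit h)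
    (i : Fin n) : evalBase ha hh (zBase i) = Tensor.inl (zHat a i) := by
  refine (IsLocalization.lift_eq _ _).trans ?_
  simp [evalPoly]

theorem evalBase_h {a : Fin n → K} (ha : Function.Injective a) {h : R} (hh : IsUnit h) :
    evalBase ha hh (hBase n) = Tensor.inr h := by
  refine (IsLocalization.lift_eq _ _).trans ?_
  simp [evalPoly]

theorem eq_zero_of_nablaFormal_eq_zero [CharP K p] (hp : p.Prime) (hpn : ¬ p ∣ n) {a : Fin n → K}
    (ha : Function.Injective a) {h : R} (hu : IsUnit h) (hh : IsUnit (h ^ p - h))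
    {v : EFormal ha hu} (hv : ∀ i, nablaFormal ha hu i v = 0) : v = 0 := by
  have hz : (fun i => algebraMap (Base n) (Via (evalBase ha hu)) (zBase i)) =
      fun i => Tensor.inl (zHat a i) := funext (evalBase_z ha hu)
  have hb : algebraMap (Base n) (Via (evalBase ha hu)) (hBase n) = Tensor.inr h :=
    evalBase_h ha hu
  let D : Fin n → Derivation ℤ (Via (evalBase ha hu)) (Via (evalBase ha hu)) := fun i => dFormal i
  refine eq_zero_of_flat D (fun i => dFormal_evalBase ha hu i) hp
    (natCast_formalRing_eq_zero (K := K) (R := R)) hpn ?_ ?_ hv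
  · rw [hz]
    exact derEnd_euler_formalRing_pow_prime hp a
  · rw [hb]
    exact isUnit_inr_pow_sub hh

/-- The prime field is exactly the set of solutions of `x^p = x` in `K`. -/
theorem pow_sub_ne_zero_of_notMem_range [CharP K p] (hp : p.Prime) {h : K}
    (hh : h ∉ Set.range (ZMod.castHom (dvd_refl p) K)) : h ^ p - h ≠ 0 := by
  have : Fact p.Prime := ⟨hp⟩
  refine fun h0 => hh ?_
  rw [← RingHom.coe_fieldRange, ZMod.fieldRange_castHom_eq_bot p]
  exact (Subfield.mem_bot_iff_pow_eq_self K p).mpr (sub_eq_zero.mp h0)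

end PowerSeries

end KZ

end

theorem mainTheorem4 (n p : ℕ) (hp : p.Prime) (hpn : ¬ p ∣ n)
    (K : Type*) [Field K] [CharP K p] (a : Fin n → K) (ha : Function.Injective a) :
    (∀ (R : Type*) [CommRing R] [Algebra (ZMod p) R] (h : R) (hh : IsUnit (h ^ p - h)),
      (∀ v : KZ.EFormal ha (KZ.isUnit_of_pow_sub hp hh),
        (∀ i, KZ.nablaFormal ha (KZ.isUnit_of_pow_sub hp hh) i v = 0) → v = 0) ∧
      (∀ I : Fin n → KZ.FormalRing n K R,
        KZ.IsKZSolution (fun i => KZ.dFormal i) (fun i => KZ.Tensor.inl (KZ.zHat a i)) (KZ.Tensor.inr h) I → I = 0)) ∧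
    (∀ h : K, h ∉ Set.range (ZMod.castHom (dvd_refl p) K) →
      ∀ I : Fin n → MvPowerSeries (Fin n) K,
        KZ.IsKZSolution (fun i => MvPowerSeries.pderiv K i) (KZ.zHat a) (MvPowerSeries.C h) I →
          I = 0) := by
  refine ⟨fun R _ _ h hh => ⟨fun v hv =>
    KZ.eq_zero_of_nablaFormal_eq_zero hp hpn ha _ hh hv, fun I hI => ?_⟩, fun h hh I hI => ?_⟩
  · refine hI.eq_zero hp KZ.natCast_formalRing_eq_zero hpn (fun i j hij => ?_)
      (KZ.derEnd_euler_formalRing_pow_prime hp a) (KZ.isUnit_inr_pow_sub hh)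
      (fun i => KZ.dFormal_inr i h)
    rw [← map_sub]
    exact (KZ.isUnit_zHat_sub ha hij).map _
  -- The second assertion is not the case `R = K` of the first, since `Â ⊗_ℤ K` is not `Â`; the
  -- general lemma is applied to `Â` itself, with `h` a constant series.
  · refine KZ.IsKZSolution.eq_zero hp KZ.natCast_mvPowerSeries_eq_zero hpn
      (D := fun i => KZ.intDer (MvPowerSeries.pderiv K i)) (fun i j => KZ.isUnit_zHat_sub ha)
      (KZ.derEnd_euler_mvPowerSeries_pow_prime hp a) ?_ (fun i => MvPowerSeries.pderiv_C) hI
    have hu := (KZ.pow_sub_ne_zero_of_notMem_range hp hh).isUnit.map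
      (MvPowerSeries.C (σ := Fin n) (R := K))
    simpa using hu
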